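/- Let $n\ge 2$ be an even integer and let $c_1,\dots,c_n\in\mathbf C$, where $c_n$ has positive real and imaginary parts. Let $H$ be any closed operator in $L^2(\mathbf R)$ which extends the operator $f\mapsto -f''+\sum_{m=1}^n c_m x^m f$ with initial domain $C_c^\infty(\mathbf R)$ (that is, $H=P^2+\sum_{m=1}^n c_mQ^m$ with $P=-i\,\mathrm d/\mathrm dx$ and $Q$ multiplication by $x$). Let $z\in\mathbf C$ satisfy $0<\arg(z)<\arg(c_n)$, where $\arg$ is the principal argument. Then $\|(H-\sigma z I)^{-1}\|$ diverges to infinity faster than any power of $\sigma$ as $\sigma\to+\infty$, that is, for every $N\in\mathbf R$, $$\lim_{\sigma\to+\infty}\sigma^{-N}\,\|(H-\sigma zI)^{-1}\|=\infty ,$$ where $\|(H-wI)^{-1}\|$ is understood as $+\infty$ when $w$ belongs to the spectrum of $H$. -/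

import Mathlib

open MeasureTheory Filter Topology
open scoped ENNReal ContDiff

noncomputable section

/-- The Hilbert space of complex-valued square integrable functions on the real line. -/
abbrev L2R : Type := Lp ℂ 2 (volume : Measure ℝ)

/-- The polynomial potential with `V x = ∑_{m=1}^n c_m x^m`. -/
def polyPotential (n : ℕ) (c : ℕ → ℂ) (x : ℝ) : ℂ :=
  ∑ m ∈ Finset.Icc 1 n, c m * (x : ℂ) ^ m

/-- The differential expression `P² f + V f = -f'' + V f`, where `P = -i d/dx`. -/
def schrodingerExpr (V : ℝ → ℂ) (f : ℝ → ℂ) (x : ℝ) : ℂ :=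
  -(iteratedDeriv 2 f x) + V x * f x

/-- The graph in `L² × L²` of the operator `f ↦ -f'' + V f` with initial domain the smooth
compactly supported functions. -/
def initialGraph (V : ℝ → ℂ) : Set (L2R × L2R) :=
  {p | ∃ f : ℝ → ℂ, ContDiff ℝ ∞ f ∧ HasCompactSupport f ∧
    (p.1 : ℝ → ℂ) =ᵐ[volume] f ∧ (p.2 : ℝ → ℂ) =ᵐ[volume] schrodingerExpr V f}

/-- `H` is a closed operator in `L²(ℝ)` which extends `f ↦ -f'' + V f`, initially defined on
the smooth compactly supported functions. -/
def IsClosedExtension (V : ℝ → ℂ) (H : L2R →ₗ.[ℂ] L2R) : Prop :=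
  H.IsClosed ∧ initialGraph V ⊆ (H.graph : Set (L2R × L2R))

/-- The bounded operator `R` is the two-sided inverse `(H - w I)⁻¹` of `H - w I`, which maps
the domain of `H` to the whole space. -/
def IsResolventAt (H : L2R →ₗ.[ℂ] L2R) (w : ℂ) (R : L2R →L[ℂ] L2R) : Prop :=
  (∀ g : L2R, ∃ hg : R g ∈ H.domain, H ⟨R g, hg⟩ - w • R g = g) ∧
    ∀ u : H.domain, R (H u - w • (u : L2R)) = u

/-- The resolvent norm `‖(H - w I)⁻¹‖` as an extended non-negative number. The resolvent is unique
where it exists, so that the infimum is then its operator norm; if `w` lies in the spectrum of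
`H`, the infimum is over the empty family and its value is `∞`. -/
def resolventNorm (H : L2R →ₗ.[ℂ] L2R) (w : ℂ) : ℝ≥0∞ :=
  ⨅ (R : L2R →L[ℂ] L2R) (_ : IsResolventAt H w R), ‖R‖ₑ

end

/-! The resolvent is bounded below by testing `H` on quasimodes: a test function f with ‖(H - w)f‖ ≤
ε‖f‖ forces every inverse of H - w to have norm at least 1/ε (`le_resolventNorm_of_quasimode`). Put
σ = sⁿ, x = s y, n = 2k and h = s^{-(k+1)}. Then H - σz becomes sⁿ(-h² d²/dy² + W_s) with W_s → W₀ =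
c_n yⁿ - z, so s → ∞ is a semiclassical limit h → 0.

The argument condition on z gives a > 0 with W₀(a) = -η² < 0 and Im W₀'(a) > 0 (`exists_symbol_eq`).
A complex WKB function exp(F/h) with F' = g satisfies -h²φ'' + Wφ = -(h g' + g² - W)φ, so g should
nearly solve a Riccati equation. Newton steps starting from g = √W reach any power of h
(`exists_approx_riccati`). With the branch G₀(a) = -iη, the sign of Im W₀'(a) means Re G₀'(a) < 0.
Hence |exp(F₀/h)|, with F₀' = G₀, decays like a Gaussian around a, and a cut-off away from a costs
only exponentially small errors (`exists_quasimode`). -/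

/-! ### Approximate solutions of the Riccati equation. -/

/-- The derivative of a function bounded on a ball is controlled on the ball of half the radius. -/
theorem norm_deriv_le_on_half_ball {f : ℂ → ℂ} {a : ℂ} {r C : ℝ} (hr : 0 < r)
    (hf : DifferentiableOn ℂ f (Metric.ball a r)) (hC : ∀ y ∈ Metric.ball a r, ‖f y‖ ≤ C)
    {y : ℂ} (hy : y ∈ Metric.ball a (r / 2)) : ‖deriv f y‖ ≤ 3 * C / r := by
  have hsub : Metric.closedBall y (r / 3) ⊆ Metric.ball a r := by
    intro w hw
    rw [Metric.mem_closedBall] at hw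
    rw [Metric.mem_ball] at hy ⊢
    linarith [dist_triangle w y a]
  have h1 : DiffContOnCl ℂ f (Metric.ball y (r / 3)) :=
    (hf.mono hsub).diffContOnCl_ball subset_rfl
  have h2 := Complex.norm_deriv_le_of_forall_mem_sphere_norm_le (c := y) (R := r / 3) (C := C)
    (by positivity) h1 (fun w hw => hC w (hsub (Metric.sphere_subset_closedBall hw)))
  calc ‖deriv f y‖ ≤ C / (r / 3) := h2
    _ = 3 * C / r := by field_simp

/-- The residual of the semiclassical Riccati equation `h g' + g² = W`. -/
noncomputable def riccatiResidual (h : ℝ) (W g : ℂ → ℂ) (y : ℂ) : ℂ :=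
  (h : ℂ) * deriv g y + g y ^ 2 - W y

/-- One Newton step for the Riccati equation. -/
theorem riccatiResidual_newton {h : ℝ} {W g : ℂ → ℂ} {y : ℂ} (hg : DifferentiableAt ℂ g y)
    (hq : DifferentiableAt ℂ (fun w => riccatiResidual h W g w / (2 * g w)) y) (h0 : g y ≠ 0) :
    riccatiResidual h W (fun w => g w - riccatiResidual h W g w / (2 * g w)) y =
      (riccatiResidual h W g y / (2 * g y)) ^ 2 -
        h * deriv (fun w => riccatiResidual h W g w / (2 * g w)) y := by
  conv_lhs => rw [riccatiResidual]
  rw [deriv_fun_sub hg hq]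
  -- With q = residual / (2g), the cross term -2gq cancels the old residual and leaves q² - h q'.
  have : riccatiResidual h W g y / (2 * g y) * (2 * g y) = h * deriv g y + g y ^ 2 - W y := by
    rw [div_mul_cancel₀ _ (by simpa using h0)]; rfl
  linear_combination -this

/-- Approximate solutions, to any order, of the semiclassical Riccati equation. -/
theorem exists_approx_riccati {ι : Type*} {l : Filter ι} {W G : ι → ℂ → ℂ} {G₀ : ℂ → ℂ}
    {h : ι → ℝ} {a : ℂ} {r m M : ℝ} (hr : 0 < r) (hm : 0 < m)
    (hh : Tendsto h l (𝓝[>] 0))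
    (hG : ∀ᶠ i in l, DifferentiableOn ℂ (G i) (Metric.ball a r))
    (hW : ∀ᶠ i in l, DifferentiableOn ℂ (W i) (Metric.ball a r))
    (hlim : TendstoUniformlyOn G G₀ l (Metric.ball a r))
    (hlow : ∀ y ∈ Metric.ball a r, m ≤ ‖G₀ y‖) (hup : ∀ y ∈ Metric.ball a r, ‖G₀ y‖ ≤ M)
    (hsq : ∀ᶠ i in l, ∀ y ∈ Metric.ball a r, G i y ^ 2 = W i y) (k : ℕ) :
    ∃ r' > 0, r' ≤ r ∧ ∃ (g : ι → ℂ → ℂ) (C : ℝ), 0 ≤ C ∧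
      (∀ᶠ i in l, DifferentiableOn ℂ (g i) (Metric.ball a r')) ∧
      TendstoUniformlyOn g G₀ l (Metric.ball a r') ∧
      ∀ᶠ i in l, ∀ y ∈ Metric.ball a r', ‖riccatiResidual (h i) (W i) (g i) y‖ ≤ C * h i ^ (k + 1) := by
  have hpos : ∀ᶠ i in l, 0 < h i := hh.eventually self_mem_nhdsWithin
  have hh0 : Tendsto h l (𝓝 0) := hh.mono_right nhdsWithin_le_nhds
  induction k with
  | zero =>
    have hM : 0 ≤ M := (norm_nonneg _).trans (hup a (Metric.mem_ball_self hr))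
    have hbd := Metric.tendstoUniformlyOn_iff.1 hlim 1 one_pos
    -- Since G² = W, the residual of G is exactly h G', and Cauchy's estimate bounds G'.
    refine ⟨r / 2, by positivity, by linarith, G, 3 * (M + 1) / r, by positivity, ?_,
      hlim.mono (Metric.ball_subset_ball (by linarith)), ?_⟩
    · exact hG.mono fun i hi => hi.mono (Metric.ball_subset_ball (by linarith))
    · filter_upwards [hpos, hG, hbd, hsq] with i hi hGi hbi hsi y hy
      have hy' : y ∈ Metric.ball a r := Metric.ball_subset_ball (by linarith) hy
      have hb : ∀ w ∈ Metric.ball a r, ‖G i w‖ ≤ M + 1 := by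
        intro w hw
        have h1 := hbi w hw
        rw [dist_comm, dist_eq_norm] at h1
        linarith [norm_le_norm_add_norm_sub' (G i w) (G₀ w), hup w hw]
      rw [riccatiResidual, hsi y hy', add_sub_cancel_right, norm_mul, Complex.norm_real,
        Real.norm_of_nonneg hi.le, zero_add, pow_one, mul_comm]
      gcongr
      exact norm_deriv_le_on_half_ball hr hGi hb hy
  | succ k ih =>
    obtain ⟨r', hr', hr'r, g, C, hC, hg, hgl, hres⟩ := ih
    have hbd := Metric.tendstoUniformlyOn_iff.1 hgl (m / 2) (by positivity)
    have hsub : Metric.ball a r' ⊆ Metric.ball a r := Metric.ball_subset_ball hr'r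
    have hsub' : Metric.ball a (r' / 2) ⊆ Metric.ball a r' := Metric.ball_subset_ball (by linarith)
    have key : ∀ᶠ i in l, (∀ y ∈ Metric.ball a r', g i y ≠ 0) ∧
        DifferentiableOn ℂ (fun w => riccatiResidual (h i) (W i) (g i) w / (2 * g i w))
          (Metric.ball a r') ∧
        ∀ y ∈ Metric.ball a r',
          ‖riccatiResidual (h i) (W i) (g i) y / (2 * g i y)‖ ≤ C / m * h i ^ (k + 1) := by
      filter_upwards [hg, hbd, hres, hW] with i hgi hbi hri hWi
      -- This gives ‖2g‖ ≥ m, the denominator in the bound C / m.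
      have hlo : ∀ y ∈ Metric.ball a r', m / 2 ≤ ‖g i y‖ := by
        intro y hy
        have h1 := hbi y hy
        rw [dist_eq_norm] at h1
        linarith [norm_le_norm_add_norm_sub' (G₀ y) (g i y), hlow y (hsub hy)]
      have hne : ∀ y ∈ Metric.ball a r', g i y ≠ 0 := by
        intro y hy h0
        have := hlo y hy
        rw [h0, norm_zero] at this
        linarith
      refine ⟨hne, ?_, ?_⟩
      · refine DifferentiableOn.div ?_ (hgi.const_mul 2) (fun y hy => by simpa using hne y hy)
        exact (((hgi.deriv Metric.isOpen_ball).const_mul _).add (hgi.pow 2)).sub (hWi.mono hsub)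
      · intro y hy
        rw [norm_div, norm_mul, Complex.norm_ofNat]
        have h1 := hlo y hy
        have h2 := hri y hy
        calc _ ≤ (C * h i ^ (k + 1)) / m := by
              gcongr
              · exact (norm_nonneg _).trans h2
              · linarith
          _ = _ := by ring
    -- The correction q is O(h^(k+1)), so q² - h q' is O(h^(k+2)): one power of h is gained.
    -- Cauchy's estimate for q' halves the radius at each step.
    refine ⟨r' / 2, by positivity, by linarith,
      fun i w => g i w - riccatiResidual (h i) (W i) (g i) w / (2 * g i w),
      (C / m) ^ 2 + 3 * (C / m) / r', by positivity, ?_, ?_, ?_⟩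
    · filter_upwards [hg, key] with i hgi hki
      exact (hgi.sub hki.2.1).mono hsub'
    · rw [Metric.tendstoUniformlyOn_iff]
      intro ε hε
      have ht : Tendsto (fun i => C / m * h i ^ (k + 1)) l (𝓝 0) := by
        simpa using (hh0.pow (k + 1)).const_mul (C / m)
      filter_upwards [Metric.tendstoUniformlyOn_iff.1 hgl (ε / 2) (by positivity), key,
        ht.eventually_lt_const (half_pos hε)] with i h1 h2 h3 y hy
      have h4 := h1 y (hsub' hy)
      have h5 := h2.2.2 y (hsub' hy)
      rw [dist_eq_norm] at h4 ⊢
      rw [show ∀ p q s : ℂ, p - (q - s) = (p - q) + s by intros; ring]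
      exact (norm_add_le _ _).trans_lt (by linarith)
    · filter_upwards [hg, key, hpos, hh0.eventually_lt_const one_pos] with i hgi hki hi hi1 y hy
      have hn : Metric.ball a r' ∈ 𝓝 y := Metric.isOpen_ball.mem_nhds (hsub' hy)
      rw [riccatiResidual_newton (hgi.differentiableAt hn) (hki.2.1.differentiableAt hn)
        (hki.1 y (hsub' hy))]
      have h1 := norm_deriv_le_on_half_ball hr' hki.2.1 hki.2.2 hy
      have h2 := hki.2.2 y (hsub' hy)
      calc _ ≤ ‖riccatiResidual (h i) (W i) (g i) y / (2 * g i y)‖ ^ 2 +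
            h i * ‖deriv (fun w => riccatiResidual (h i) (W i) (g i) w / (2 * g i w)) y‖ := by
            refine (norm_sub_le _ _).trans_eq ?_
            rw [norm_pow, norm_mul, Complex.norm_real, Real.norm_of_nonneg hi.le]
        _ ≤ (C / m * h i ^ (k + 1)) ^ 2 + h i * (3 * (C / m * h i ^ (k + 1)) / r') := by gcongr
        _ = (C / m) ^ 2 * h i ^ (k + 1 + 1 + k) + 3 * (C / m) / r' * h i ^ (k + 1 + 1) := by ring
        _ ≤ (C / m) ^ 2 * h i ^ (k + 1 + 1) + 3 * (C / m) / r' * h i ^ (k + 1 + 1) := by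
            gcongr ?_ * ?_ + _
            exact pow_le_pow_of_le_one hi.le hi1.le (by omega)
        _ = _ := by ring

/-! ### WKB quasimodes. -/

/-- A strict second-order estimate for the real part of a primitive at a critical point. -/
theorem re_primitive_le_neg_sq {F G : ℂ → ℂ} {a r : ℝ} (hr : 0 < r)
    (hF : ∀ y ∈ Metric.ball (a : ℂ) r, HasDerivAt F (G y) y) (hG : DifferentiableAt ℂ G a)
    (hFa : F a = 0) (hre : (G a).re = 0) (hderiv : (deriv G a).re < 0) :
    ∃ κ > 0, ∃ d > 0, ∀ x : ℝ, |x - a| < d → (F x).re ≤ -(κ * (x - a) ^ 2) := by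
  -- With this κ, Re F + κ(x - a)² has second derivative Re G'(a) / 2 < 0 at its critical point a,
  -- hence a local maximum there, of value 0.
  set κ : ℝ := -(deriv G a).re / 4 with hκ
  have hκ0 : 0 < κ := by rw [hκ]; linarith
  set p : ℝ → ℝ := fun x => (F x).re + κ * (x - a) ^ 2 with hp
  have hpd : ∀ x ∈ Metric.ball a r, HasDerivAt p ((G x).re + κ * (2 * (x - a))) x := by
    intro x hx
    have h1 := (hF x (by simpa [Complex.dist_eq, ← Complex.ofReal_sub, Real.dist_eq] using hx)).real_of_complex
    have h2 : HasDerivAt (fun x : ℝ => κ * (x - a) ^ 2) (κ * (2 * (x - a))) x := by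
      simpa using (((hasDerivAt_id x).sub_const a).pow 2).const_mul κ
    exact h1.add h2
  have hda : deriv p a = 0 := by
    rw [(hpd a (Metric.mem_ball_self hr)).deriv, hre]; ring
  have hdd : deriv (deriv p) a < 0 := by
    have he : deriv p =ᶠ[𝓝 a] fun x : ℝ => (G x).re + κ * (2 * (x - a)) := by
      filter_upwards [Metric.ball_mem_nhds a hr] with x hx using (hpd x hx).deriv
    have h2 : HasDerivAt (fun x : ℝ => κ * (2 * (x - a))) (κ * 2) a := by
      simpa using (((hasDerivAt_id a).sub_const a).const_mul 2).const_mul κ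
    have h3 : HasDerivAt (fun x : ℝ => (G x).re + κ * (2 * (x - a))) ((deriv G a).re + κ * 2) a :=
      hG.hasDerivAt.real_of_complex.add h2
    rw [he.deriv_eq, h3.deriv, hκ]
    linarith
  have hmax := isLocalMax_of_deriv_deriv_neg hdd hda
    (hpd a (Metric.mem_ball_self hr)).continuousAt
  obtain ⟨d, hd, hd'⟩ := Metric.eventually_nhds_iff.1 hmax
  refine ⟨κ, hκ0, d, hd, fun x hx => ?_⟩
  have := hd' (y := x) (by rwa [Real.dist_eq])
  simp only [hp, hFa, Complex.zero_re, sub_self] at this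
  linarith

/-- The action of `-h² d²/dx² + W` on a cut-off exponential `χ exp (F / h)`. -/
theorem cutoff_exponential {a h r : ℝ} (hh : h ≠ 0) {W F g : ℂ → ℂ} {χ : ℝ → ℝ}
    (hχ : ContDiff ℝ ∞ χ) (hsupp : tsupport χ ⊆ Metric.ball a r)
    (hF : ∀ y ∈ Metric.ball (a : ℂ) r, HasDerivAt F (g y) y)
    (hg : DifferentiableOn ℂ g (Metric.ball (a : ℂ) r)) :
    ContDiff ℝ ∞ (fun x : ℝ => (χ x : ℂ) * Complex.exp (F x / h)) ∧
    ∀ x ∈ Metric.ball a r,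
      -(h : ℂ) ^ 2 * iteratedDeriv 2 (fun x : ℝ => (χ x : ℂ) * Complex.exp (F x / h)) x +
          W x * ((χ x : ℂ) * Complex.exp (F x / h)) =
        -(riccatiResidual h W g x * ((χ x : ℂ) * Complex.exp (F x / h))) -
          (h ^ 2 * ((deriv (deriv χ) x : ℝ) : ℂ) + 2 * h * ((deriv χ x : ℝ) : ℂ) * g x) *
            Complex.exp (F x / h) := by
  have hmem : ∀ x ∈ Metric.ball a r, (x : ℂ) ∈ Metric.ball (a : ℂ) r := by
    intro x hx
    simpa [Complex.dist_eq, ← Complex.ofReal_sub, Real.dist_eq] using hx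
  -- Nothing is known about F outside the ball; smoothness there comes from χ vanishing nearby.
  have hloc : ∀ x ∉ Metric.ball a r,
      (fun x : ℝ => (χ x : ℂ) * Complex.exp (F x / h)) =ᶠ[𝓝 x] fun _ => 0 := by
    intro x hx
    have h1 : x ∉ tsupport χ := fun h => hx (hsupp h)
    filter_upwards [notMem_tsupport_iff_eventuallyEq.1 h1] with y hy
    simp [hy]
  have hh' : (h : ℂ) ≠ 0 := by exact_mod_cast hh
  refine ⟨contDiff_iff_contDiffAt.2 fun x => ?_, fun x hx => ?_⟩
  · by_cases hx : x ∈ Metric.ball a r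
    · have h1 : ContDiffAt ℂ ∞ F x := by
        have : DifferentiableOn ℂ F (Metric.ball (a : ℂ) r) :=
          fun y hy => (hF y hy).differentiableAt.differentiableWithinAt
        exact (this.analyticAt (Metric.isOpen_ball.mem_nhds (hmem x hx))).contDiffAt
      have h2 : ContDiffAt ℝ ∞ (fun x : ℝ => F x) x :=
        (h1.restrict_scalars ℝ).comp x Complex.ofRealCLM.contDiff.contDiffAt
      exact (Complex.ofRealCLM.contDiff.contDiffAt.comp x hχ.contDiffAt).mul
        ((h2.div_const _).cexp)
    · exact contDiffAt_const.congr_of_eventuallyEq (hloc x hx)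
  · have hE : ∀ y ∈ Metric.ball a r, HasDerivAt (fun x : ℝ => Complex.exp (F x / h))
        (Complex.exp (F y / h) * (g y / h)) y := fun y hy =>
      ((hF y (hmem y hy)).comp_ofReal.div_const _).cexp
    have hχ1 : ∀ y, HasDerivAt (fun x : ℝ => (χ x : ℂ)) ((deriv χ y : ℝ) : ℂ) y := fun y =>
      ((hχ.differentiable (by simp)).differentiableAt.hasDerivAt).ofReal_comp
    have hχ2 : ∀ y, HasDerivAt (fun x : ℝ => ((deriv χ x : ℝ) : ℂ)) ((deriv (deriv χ) y : ℝ) : ℂ) y := fun y =>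
      (((contDiff_infty_iff_deriv.1 hχ).2.differentiable
        (by simp)).differentiableAt.hasDerivAt).ofReal_comp
    have h1 : deriv (fun x : ℝ => (χ x : ℂ) * Complex.exp (F x / h)) =ᶠ[𝓝 x]
        fun y : ℝ => ((deriv χ y : ℝ) : ℂ) * Complex.exp (F y / h) +
          (χ y : ℂ) * (Complex.exp (F y / h) * (g y / h)) := by
      filter_upwards [Metric.isOpen_ball.mem_nhds hx] with y hy
      exact ((hχ1 y).mul (hE y hy)).deriv
    have hg' : HasDerivAt (fun y : ℝ => g y) (deriv g x) x :=
      ((hg.differentiableAt (Metric.isOpen_ball.mem_nhds (hmem x hx))).hasDerivAt).comp_ofReal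
    rw [iteratedDeriv_succ, iteratedDeriv_one, h1.deriv_eq,
      (((hχ2 x).fun_mul (hE x hx)).fun_add
        ((hχ1 x).fun_mul ((hE x hx).fun_mul (hg'.div_const (h : ℂ))))).deriv, riccatiResidual]
    field_simp
    ring

/-- With t = 1/h this is t^K exp(-bt) → 0. It makes the cut-off errors smaller than any prescribed
power of h. -/
theorem eventually_mul_exp_neg_div_le_pow {ι : Type*} {l : Filter ι} {h : ι → ℝ}
    (hh : Tendsto h l (𝓝[>] 0)) (B : ℝ) {b : ℝ} (hb : 0 < b) (K : ℕ) :
    ∀ᶠ i in l, B * Real.exp (-b / h i) ≤ h i ^ K := by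
  have h1 := ((tendsto_rpow_mul_exp_neg_mul_atTop_nhds_zero K b hb).comp
    (tendsto_inv_nhdsGT_zero.comp hh)).const_mul B
  rw [mul_zero] at h1
  filter_upwards [h1.eventually_lt_const one_pos, hh.eventually self_mem_nhdsWithin] with i hi hp
  have hp : 0 < h i := hp
  simp only [Function.comp_apply, Real.rpow_natCast, inv_pow] at hi
  rw [show -b / h i = -b * (h i)⁻¹ from div_eq_mul_inv _ _]
  have hk : 0 < h i ^ K := by positivity
  calc B * Real.exp (-b * (h i)⁻¹)
      = h i ^ K * (B * ((h i ^ K)⁻¹ * Real.exp (-b * (h i)⁻¹))) := by field_simp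
    _ ≤ h i ^ K * 1 := by gcongr
    _ = _ := mul_one _

/-- A smooth function with compact support has bounded first two derivatives. -/
theorem exists_bound_deriv_of_hasCompactSupport {χ : ℝ → ℝ} (hχ : ContDiff ℝ ∞ χ)
    (hc : HasCompactSupport χ) :
    ∃ B, 0 ≤ B ∧ ∀ x, |deriv χ x| ≤ B ∧ |deriv (deriv χ) x| ≤ B := by
  have h1 := (contDiff_infty_iff_deriv.1 hχ).2
  have h2 := (contDiff_infty_iff_deriv.1 h1).2
  obtain ⟨B₁, hB₁⟩ := h1.continuous.bounded_above_of_compact_support hc.deriv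
  obtain ⟨B₂, hB₂⟩ := h2.continuous.bounded_above_of_compact_support hc.deriv.deriv
  exact ⟨max B₁ B₂, (norm_nonneg _).trans ((hB₁ 0).trans (le_max_left _ _)),
    fun x => ⟨(hB₁ x).trans (le_max_left _ _), (hB₂ x).trans (le_max_right _ _)⟩⟩

/-- Semiclassical quasimodes for a family of holomorphic potentials `W i` near a point where the
complex eikonal equation has a solution with decaying exponential. -/
theorem exists_quasimode {ι : Type*} {l : Filter ι} {W G : ι → ℂ → ℂ} {G₀ : ℂ → ℂ}
    {h : ι → ℝ} {a r m M : ℝ} (hr : 0 < r) (hm : 0 < m)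
    (hh : Tendsto h l (𝓝[>] 0))
    (hG : ∀ᶠ i in l, DifferentiableOn ℂ (G i) (Metric.ball (a : ℂ) r))
    (hG₀ : DifferentiableOn ℂ G₀ (Metric.ball (a : ℂ) r))
    (hW : ∀ᶠ i in l, DifferentiableOn ℂ (W i) (Metric.ball (a : ℂ) r))
    (hlim : TendstoUniformlyOn G G₀ l (Metric.ball (a : ℂ) r))
    (hlow : ∀ y ∈ Metric.ball (a : ℂ) r, m ≤ ‖G₀ y‖)
    (hup : ∀ y ∈ Metric.ball (a : ℂ) r, ‖G₀ y‖ ≤ M)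
    (hsq : ∀ᶠ i in l, ∀ y ∈ Metric.ball (a : ℂ) r, G i y ^ 2 = W i y)
    (hre : (G₀ a).re = 0) (hderiv : (deriv G₀ a).re < 0) (K : ℕ) :
    ∃ c > 0, ∀ᶠ i in l, ∃ φ : ℝ → ℂ, ContDiff ℝ ∞ φ ∧ HasCompactSupport φ ∧
      (∀ x ∈ Metric.closedBall a (h i), c ≤ ‖φ x‖) ∧
      (∀ x ∈ Metric.closedBall a 1,
        ‖-(h i : ℂ) ^ 2 * iteratedDeriv 2 φ x + W i x * φ x‖ ≤ h i ^ K * (‖φ x‖ + 1)) ∧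
      ∀ x ∉ Metric.closedBall a 1,
        ‖-(h i : ℂ) ^ 2 * iteratedDeriv 2 φ x + W i x * φ x‖ ≤ h i ^ K * ‖φ x‖ := by
  have hpos : ∀ᶠ i in l, 0 < h i := hh.eventually self_mem_nhdsWithin
  have hh0 : Tendsto h l (𝓝 0) := hh.mono_right nhdsWithin_le_nhds
  obtain ⟨s, hs, hsr, g, C, hC, hg, hgl, hres⟩ :=
    exists_approx_riccati hr hm hh hG hW hlim hlow hup hsq K
  have hsub : Metric.ball (a : ℂ) s ⊆ Metric.ball a r := Metric.ball_subset_ball hsr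
  have ha : (a : ℂ) ∈ Metric.ball (a : ℂ) r := Metric.mem_ball_self hr
  have hM : 0 ≤ M := (norm_nonneg _).trans (hup a ha)
  obtain ⟨F₀, hF₀a, hF₀⟩ := hG₀.isExactOn_ball.with_val_at a 0
  obtain ⟨κ, hκ, d, hd, hdecay⟩ := re_primitive_le_neg_sq hr hF₀
    (hG₀.differentiableAt (Metric.isOpen_ball.mem_nhds ha)) hF₀a hre hderiv
  obtain ⟨δ, hδ, hδd, hδs, hδ1⟩ : ∃ δ > 0, δ < d ∧ δ < s ∧ δ ≤ 1 :=
    ⟨min (min (d / 2) (s / 2)) 1, by positivity,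
      (min_le_left _ _).trans_lt ((min_le_left _ _).trans_lt (by linarith)),
      (min_le_left _ _).trans_lt ((min_le_right _ _).trans_lt (by linarith)), min_le_right _ _⟩
  let χ : ContDiffBump a := ⟨δ / 2, δ, by positivity, by linarith⟩
  have hχs : tsupport χ = Metric.closedBall a δ := χ.tsupport_eq
  have hsupp : tsupport χ ⊆ Metric.ball a s := by
    rw [hχs]; exact Metric.closedBall_subset_ball hδs
  have hχc : ContDiff ℝ ∞ χ := χ.contDiff
  obtain ⟨B, hB, hχB⟩ := exists_bound_deriv_of_hasCompactSupport hχc χ.hasCompactSupport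
  set b : ℝ := κ * δ ^ 2 / 8 with hb
  have hb0 : 0 < b := by positivity
  -- The bound 1 gives ‖g‖ ≤ M + 1. The bound κδ/8 keeps F close enough to F₀ to inherit its decay
  -- on δ/2 ≤ |x - a| ≤ δ, where -κt² + κδt/8 ≤ -b for t = |x - a|. Near a no decay of F is needed.
  have hclose := Metric.tendstoUniformlyOn_iff.1 hgl (min 1 (κ * δ / 8)) (by positivity)
  refine ⟨Real.exp (-(M + 1)), Real.exp_pos _, ?_⟩
  -- The residual is O(h^(K+1)); the spare power of h absorbs C.
  have hres' : ∀ᶠ i in l, C * h i ≤ 1 := by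
    have : Tendsto (fun i => C * h i) l (𝓝 0) := by simpa using hh0.const_mul C
    exact (this.eventually_lt_const one_pos).mono fun i hi => hi.le
  filter_upwards [hpos, hg, hres, hclose, hres', hh0.eventually_lt_const one_pos,
    hh0.eventually_lt_const (half_pos hδ),
    eventually_mul_exp_neg_div_le_pow hh (B + 2 * B * (M + 1)) hb0 K]
    with i hi hgi hri hci hCi hi1 hiδ hexp
  obtain ⟨F, hFa, hF⟩ := hgi.isExactOn_ball.with_val_at a 0
  have hmem : ∀ x ∈ Metric.ball a s, (x : ℂ) ∈ Metric.ball (a : ℂ) s := by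
    intro x hx
    simpa [Complex.dist_eq, ← Complex.ofReal_sub, Real.dist_eq] using hx
  have hgM : ∀ y ∈ Metric.ball (a : ℂ) s, ‖g i y‖ ≤ M + 1 := by
    intro y hy
    have h1 := (hci y hy).trans_le (min_le_left _ _)
    rw [dist_comm, dist_eq_norm] at h1
    linarith [norm_le_norm_add_norm_sub' (g i y) (G₀ y), hup y (hsub hy)]
  have has : (a : ℂ) ∈ Metric.ball (a : ℂ) s := Metric.mem_ball_self hs
  have hFM : ∀ x ∈ Metric.ball a s, ‖F x‖ ≤ (M + 1) * |x - a| := by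
    intro x hx
    have := (convex_ball (a : ℂ) s).norm_image_sub_le_of_norm_hasDerivWithin_le
      (fun y hy => (hF y hy).hasDerivWithinAt) hgM has (hmem x hx)
    rwa [hFa, sub_zero, ← Complex.ofReal_sub, Complex.norm_real] at this
  have hFd : ∀ x ∈ Metric.ball a s, ‖F x - F₀ x‖ ≤ κ * δ / 8 * |x - a| := by
    intro x hx
    have := (convex_ball (a : ℂ) s).norm_image_sub_le_of_norm_hasDerivWithin_le
      (f := fun y => F y - F₀ y)
      (fun y hy => ((hF y hy).sub (hF₀ y (hsub hy))).hasDerivWithinAt)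
      (fun y hy => by
        rw [← dist_eq_norm, dist_comm]
        exact ((hci y hy).trans_le (min_le_right _ _)).le) has (hmem x hx)
    simp only [hFa, hF₀a, sub_zero, ← Complex.ofReal_sub, Complex.norm_real] at this
    exact this
  obtain ⟨hφ, hin⟩ := cutoff_exponential (W := W i) hi.ne' hχc hsupp hF hgi
  have hEn : ∀ x : ℝ, ‖Complex.exp (F x / h i)‖ = Real.exp ((F x).re / h i) := by
    intro x; rw [Complex.norm_exp, Complex.div_ofReal_re]
  have hcut : ∀ x : ℝ, |x - a| ≤ δ →
      ‖((h i : ℂ) ^ 2 * ((deriv (deriv χ) x : ℝ) : ℂ) +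
        2 * h i * ((deriv χ x : ℝ) : ℂ) * g i x) * Complex.exp (F x / h i)‖ ≤ h i ^ K := by
    intro x hx
    have hxs : x ∈ Metric.ball a s := by rw [Metric.mem_ball, Real.dist_eq]; linarith
    rcases lt_or_ge |x - a| (δ / 2) with hlt | hge
    · have h1 : (χ : ℝ → ℝ) =ᶠ[𝓝 x] fun _ => 1 :=
        χ.eventuallyEq_one_of_mem_ball (by simpa [Real.dist_eq, χ] using hlt)
      have h2 := h1.deriv
      rw [h2.deriv_eq, h2.eq_of_nhds]
      simpa using pow_nonneg hi.le K
    · have h1 := hdecay x (by linarith)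
      have h2 := (Complex.abs_re_le_norm (F x - F₀ x)).trans (hFd x hxs)
      rw [Complex.sub_re] at h2
      have h3 : (F x).re ≤ -b := by
        have h4 := (abs_le.1 h2).2
        rw [← sq_abs] at h1
        rw [hb]
        nlinarith [mul_nonneg hκ.le (mul_nonneg (sub_nonneg.2 hge) (sub_nonneg.2 hge)),
          mul_nonneg hκ.le (mul_nonneg (sub_nonneg.2 hge) hδ.le), mul_pos hκ (mul_pos hδ hδ)]
      rw [norm_mul, hEn]
      refine le_trans (mul_le_mul ?_ (Real.exp_le_exp.2 (div_le_div_of_nonneg_right h3 hi.le))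
        (Real.exp_pos _).le (by positivity)) hexp
      refine (norm_add_le _ _).trans ?_
      simp only [norm_mul, norm_pow, Complex.norm_real, Real.norm_of_nonneg hi.le,
        Complex.norm_ofNat, Real.norm_eq_abs]
      have hh1 : h i ^ 2 ≤ 1 := pow_le_one₀ hi.le hi1.le
      calc h i ^ 2 * |deriv (deriv χ) x| + 2 * h i * |deriv χ x| * ‖g i x‖
          ≤ 1 * B + 2 * 1 * B * (M + 1) := by
            gcongr
            · exact (hχB x).2
            · exact (hχB x).1
            · exact hgM x (hmem x hxs)
        _ = B + 2 * B * (M + 1) := by ring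
  have hfar : ∀ x : ℝ, δ < |x - a| →
      (fun x : ℝ => (χ x : ℂ) * Complex.exp (F x / h i)) =ᶠ[𝓝 x] fun _ => 0 := by
    intro x hx
    have h1 : x ∉ tsupport χ := by
      rw [hχs, Metric.mem_closedBall, Real.dist_eq]; exact not_le.2 hx
    filter_upwards [notMem_tsupport_iff_eventuallyEq.1 h1] with y hy
    simp [hy]
  have hfar' : ∀ x : ℝ, δ < |x - a| → iteratedDeriv 2
      (fun x : ℝ => (χ x : ℂ) * Complex.exp (F x / h i)) x = 0 ∧
        (χ x : ℂ) * Complex.exp (F x / h i) = 0 := by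
    intro x hx
    refine ⟨?_, (hfar x hx).eq_of_nhds⟩
    rw [iteratedDeriv_succ, iteratedDeriv_one, (hfar x hx).deriv.deriv_eq]
    simp
  refine ⟨_, hφ, ?_, ?_, ?_, ?_⟩
  · exact (χ.hasCompactSupport.comp_left (g := ((↑) : ℝ → ℂ)) (by simp)).mul_right
  · intro x hx
    have hxd : |x - a| ≤ h i := by simpa [Real.dist_eq] using hx
    have h1 : χ x = 1 := χ.one_of_mem_closedBall (by
      simp only [Metric.mem_closedBall, Real.dist_eq, χ]; linarith)
    rw [h1, Complex.ofReal_one, one_mul, hEn]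
    -- For |x - a| ≤ h, |F| ≤ (M + 1)h, so dividing by h leaves a bound independent of h.
    apply Real.exp_le_exp.2
    rw [le_div_iff₀ hi]
    have h2 := hFM x (by rw [Metric.mem_ball, Real.dist_eq]; linarith)
    have h3 := (abs_le.1 (Complex.abs_re_le_norm (F x))).1
    nlinarith
  · intro x _
    rcases le_or_gt |x - a| δ with hx | hx
    · have hxs : x ∈ Metric.ball a s := by rw [Metric.mem_ball, Real.dist_eq]; linarith
      rw [hin x hxs]
      refine (norm_sub_le _ _).trans ?_
      rw [norm_neg, norm_mul, mul_add, mul_one]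
      refine add_le_add (mul_le_mul_of_nonneg_right ?_ (norm_nonneg _)) (hcut x hx)
      calc _ ≤ C * h i ^ (K + 1) := hri x (hmem x hxs)
        _ = h i ^ K * (C * h i) := by ring
        _ ≤ h i ^ K * 1 := by gcongr
        _ = _ := mul_one _
    · rw [(hfar' x hx).1, (hfar' x hx).2]
      simpa using pow_nonneg hi.le K
  · intro x hx
    rw [Metric.mem_closedBall, Real.dist_eq, not_le] at hx
    rw [(hfar' x (by linarith)).1, (hfar' x (by linarith)).2]
    simp

/-- Quasimodes for holomorphic potentials `W i → W₀` at a point `a` where `W₀ a` is negative and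
`Im W₀' a` is positive. -/
theorem exists_quasimode_of_tendstoUniformlyOn {ι : Type*} {l : Filter ι} {W : ι → ℂ → ℂ}
    {W₀ : ℂ → ℂ} {h : ι → ℝ} {a η r : ℝ} (hr : 0 < r) (hη : 0 < η) (hh : Tendsto h l (𝓝[>] 0))
    (hW : ∀ᶠ i in l, DifferentiableOn ℂ (W i) (Metric.ball (a : ℂ) r))
    (hW₀ : DifferentiableOn ℂ W₀ (Metric.ball (a : ℂ) r))
    (hlim : TendstoUniformlyOn W W₀ l (Metric.ball (a : ℂ) r))
    (hWa : W₀ a = -(η : ℂ) ^ 2) (hderiv : 0 < (deriv W₀ a).im) (K : ℕ) :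
    ∃ c > 0, ∀ᶠ i in l, ∃ φ : ℝ → ℂ, ContDiff ℝ ∞ φ ∧ HasCompactSupport φ ∧
      (∀ x ∈ Metric.closedBall a (h i), c ≤ ‖φ x‖) ∧
      (∀ x ∈ Metric.closedBall a 1,
        ‖-(h i : ℂ) ^ 2 * iteratedDeriv 2 φ x + W i x * φ x‖ ≤ h i ^ K * (‖φ x‖ + 1)) ∧
      ∀ x ∉ Metric.closedBall a 1,
        ‖-(h i : ℂ) ^ 2 * iteratedDeriv 2 φ x + W i x * φ x‖ ≤ h i ^ K * ‖φ x‖ := by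
  have haR : (a : ℂ) ∈ Metric.ball (a : ℂ) r := Metric.mem_ball_self hr
  have hcont : ContinuousAt W₀ a :=
    (hW₀.differentiableAt (Metric.isOpen_ball.mem_nhds haR)).continuousAt
  obtain ⟨d, hd, hd'⟩ := Metric.continuousAt_iff.1 hcont (η ^ 2 / 4) (by positivity)
  obtain ⟨s, hs, hsr, hsd⟩ : ∃ s > 0, s ≤ r ∧ s ≤ d :=
    ⟨min r d, by positivity, min_le_left _ _, min_le_right _ _⟩
  have hsub : Metric.ball (a : ℂ) s ⊆ Metric.ball a r := Metric.ball_subset_ball hsr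
  have ha : (a : ℂ) ∈ Metric.ball (a : ℂ) s := Metric.mem_ball_self hs
  -- A compact disc in the right half-plane containing all values of -W near a: there the principal
  -- square root is holomorphic and uniformly continuous, so W i → W₀ passes to the roots.
  set S : Set ℂ := Metric.closedBall ((η ^ 2 : ℝ) : ℂ) (η ^ 2 / 2) with hS
  have hSre : ∀ w ∈ S, η ^ 2 / 2 ≤ w.re := by
    intro w hw
    rw [hS, Metric.mem_closedBall, dist_eq_norm] at hw
    have h1 := (abs_le.1 ((Complex.abs_re_le_norm _).trans hw)).1
    rw [Complex.sub_re, Complex.ofReal_re] at h1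
    linarith
  have hSslit : S ⊆ Complex.slitPlane := fun w hw =>
    Or.inl (lt_of_lt_of_le (by positivity) (hSre w hw))
  have hS₀ : ∀ y ∈ Metric.ball (a : ℂ) s, dist (-W₀ y) ((η ^ 2 : ℝ) : ℂ) < η ^ 2 / 4 := by
    intro y hy
    have h1 := hd' (Metric.ball_subset_ball hsd hy)
    rw [hWa, ← dist_neg_neg, neg_neg] at h1
    simpa using h1
  have hS₀' : ∀ y ∈ Metric.ball (a : ℂ) s, -W₀ y ∈ S := fun y hy =>
    Metric.mem_closedBall.2 ((hS₀ y hy).le.trans (by nlinarith))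
  have hSi : ∀ᶠ i in l, ∀ y ∈ Metric.ball (a : ℂ) s, -W i y ∈ S := by
    filter_upwards [Metric.tendstoUniformlyOn_iff.1 (hlim.mono hsub) (η ^ 2 / 4) (by positivity)]
      with i hi y hy
    have h1 := hi y hy
    have h2 := hS₀ y hy
    rw [← dist_neg_neg, dist_comm] at h1
    rw [hS, Metric.mem_closedBall]
    linarith [dist_triangle (-W i y) (-W₀ y) ((η ^ 2 : ℝ) : ℂ)]
  have hsqrt : ∀ w : ℂ, Complex.sqrt w ^ 2 = w := fun w => by
    simp [Complex.sqrt]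
  have hUC : UniformContinuousOn (fun w => -Complex.I * Complex.sqrt (-w)) (-S) := by
    have hc : IsCompact (-S) := (isCompact_closedBall _ _).neg
    refine hc.uniformContinuousOn_of_continuous (continuousOn_const.mul ?_)
    exact (Complex.continuousOn_sqrt.mono hSslit).comp continuousOn_neg
      (fun w hw => Set.mem_neg.1 hw)
  have hlimG := hUC.comp_tendstoUniformlyOn_eventually
    (hSi.mono fun i hi y hy => Set.mem_neg.2 (hi y hy))
    (fun y hy => Set.mem_neg.2 (hS₀' y hy)) (hlim.mono hsub)
  have hdiff : ∀ V : ℂ → ℂ, DifferentiableOn ℂ V (Metric.ball (a : ℂ) r) →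
      (∀ y ∈ Metric.ball (a : ℂ) s, -V y ∈ S) →
      DifferentiableOn ℂ (fun y => -Complex.I * Complex.sqrt (-V y)) (Metric.ball (a : ℂ) s) := by
    intro V hV hVS
    exact (Complex.differentiableOn_sqrt.comp (hV.mono hsub).neg
      (fun y hy => hSslit (hVS y hy))).const_mul _
  have hsqI : ∀ w : ℂ, (-Complex.I * Complex.sqrt (-w)) ^ 2 = w := by
    intro w
    rw [mul_pow, hsqrt, neg_sq, Complex.I_sq]
    ring
  have hG₀d := hdiff W₀ hW₀ hS₀'
  have hnorm : ∀ w : ℂ, ‖-Complex.I * Complex.sqrt (-w)‖ ^ 2 = ‖-w‖ := by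
    intro w
    rw [← norm_pow, hsqI, norm_neg]
  have hGa : -Complex.I * Complex.sqrt (-W₀ a) = -Complex.I * η := by
    have h1 : Complex.sqrt ((η ^ 2 : ℝ) : ℂ) = η := by
      have h2 := Complex.ofReal_cpow (sq_nonneg η) ((2 : ℕ) : ℝ)⁻¹
      rw [Real.pow_rpow_inv_natCast hη.le two_ne_zero] at h2
      rw [Complex.sqrt, h2]
      norm_num
    rw [hWa, neg_neg, ← Complex.ofReal_pow, h1]
  refine exists_quasimode (G := fun i y => -Complex.I * Complex.sqrt (-W i y))
    (G₀ := fun y => -Complex.I * Complex.sqrt (-W₀ y)) (m := η / 2) (M := 2 * η) hs (by positivity)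
    hh ?_ hG₀d ?_ hlimG ?_ ?_ ?_ ?_ ?_ K
  · filter_upwards [hW, hSi] with i h1 h2 using hdiff _ h1 h2
  · exact hW.mono fun i hi => hi.mono hsub
  · intro y hy
    refine (sq_le_sq₀ (by positivity) (norm_nonneg _)).1 ?_
    rw [hnorm]
    have := (hSre _ (hS₀' y hy)).trans (Complex.re_le_norm _)
    nlinarith
  · intro y hy
    refine (sq_le_sq₀ (norm_nonneg _) (by positivity)).1 ?_
    rw [hnorm]
    have h1 := hS₀ y hy
    rw [dist_eq_norm] at h1
    have h2 := norm_le_norm_add_norm_sub' (-W₀ y) ((η ^ 2 : ℝ) : ℂ)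
    rw [Complex.norm_real, Real.norm_of_nonneg (by positivity)] at h2
    nlinarith
  · exact Eventually.of_forall fun i y _ => hsqI _
  · simp [hGa]
  -- Differentiating G₀² = W₀ at a gives W₀'(a) = -2iηG₀'(a), so Im W₀'(a) = -2η Re G₀'(a); this is
  -- why the branch -i√(-W) is taken.
  · have hWd : HasDerivAt W₀ (deriv W₀ a) a :=
      (hW₀.differentiableAt (Metric.isOpen_ball.mem_nhds haR)).hasDerivAt
    have hGd := (hG₀d.differentiableAt (Metric.isOpen_ball.mem_nhds ha)).hasDerivAt
    have h1 := hGd.fun_pow 2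
    simp only [hsqI] at h1
    have h2 := hWd.unique h1
    rw [hGa] at h2
    set D := deriv (fun y => -Complex.I * Complex.sqrt (-W₀ y)) a
    have h3 : (deriv W₀ a).im = -2 * η * D.re := by
      rw [h2]; simp
    rw [h3] at hderiv
    by_contra! h4
    nlinarith [mul_nonneg hη.le h4]

/-! ### From quasimodes to resolvent bounds. -/

/-- Comparison of `L²` norms from pointwise estimates. -/
theorem eLpNorm_two_le_of_pointwise {f v : ℝ → ℂ} (hf : AEStronglyMeasurable f volume)
    {I J : Set ℝ} (hI : MeasurableSet I) (hJ : MeasurableSet J) {ε c A : ℝ} (hε : 0 ≤ ε)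
    (hc : 0 < c) (hA : 0 ≤ A) (hvol : volume J ≤ ENNReal.ofReal (A ^ 2) * volume I)
    (hlow : ∀ x ∈ I, c ≤ ‖f x‖) (hin : ∀ x ∈ J, ‖v x‖ ≤ ε * (‖f x‖ + 1))
    (hout : ∀ x ∉ J, ‖v x‖ ≤ ε * ‖f x‖) :
    eLpNorm v 2 volume ≤ ENNReal.ofReal (ε * (1 + A / c)) * eLpNorm f 2 volume := by
  have h1 : eLpNorm v 2 volume ≤
      eLpNorm ((ε • fun x => ‖f x‖) + ε • J.indicator (fun _ => (1 : ℝ))) 2 volume := by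
    refine eLpNorm_mono_real fun x => ?_
    by_cases hx : x ∈ J
    · simpa [hx, mul_add] using hin x hx
    · simpa [hx] using hout x hx
  have h2 : ENNReal.ofReal c * volume I ^ (1 / 2 : ℝ) ≤ eLpNorm f 2 volume := by
    have h3 : eLpNorm (I.indicator fun _ => c) 2 volume ≤ eLpNorm f 2 volume := by
      refine eLpNorm_mono fun x => ?_
      by_cases hx : x ∈ I
      · simpa [hx, abs_of_pos hc] using hlow x hx
      · simp [hx]
    rw [eLpNorm_indicator_const hI two_ne_zero ENNReal.ofNat_ne_top,
      Real.enorm_of_nonneg hc.le] at h3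
    simpa using h3
  -- The additive 1 on J is absorbed by the mass of f on I: ‖1_J‖ ≤ A‖1_I‖ ≤ (A / c)‖f‖.
  have h4 : eLpNorm (J.indicator fun _ => (1 : ℝ)) 2 volume ≤
      ENNReal.ofReal (A / c) * eLpNorm f 2 volume := by
    rw [eLpNorm_indicator_const hJ two_ne_zero ENNReal.ofNat_ne_top]
    calc ‖(1 : ℝ)‖ₑ * volume J ^ (1 / (2 : ℝ≥0∞).toReal) = volume J ^ (1 / 2 : ℝ) := by simp
      _ ≤ (ENNReal.ofReal (A ^ 2) * volume I) ^ (1 / 2 : ℝ) := by gcongr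
      _ = ENNReal.ofReal A * volume I ^ (1 / 2 : ℝ) := by
          rw [ENNReal.mul_rpow_of_nonneg _ _ (by norm_num),
            ENNReal.ofReal_rpow_of_nonneg (by positivity) (by norm_num), ← Real.sqrt_eq_rpow,
            Real.sqrt_sq hA]
      _ = ENNReal.ofReal (A / c) * (ENNReal.ofReal c * volume I ^ (1 / 2 : ℝ)) := by
          rw [← mul_assoc, ← ENNReal.ofReal_mul (by positivity), div_mul_cancel₀ _ hc.ne']
      _ ≤ _ := by gcongr
  refine h1.trans ((eLpNorm_add_le (hf.norm.const_smul ε)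
    ((aestronglyMeasurable_const.indicator hJ).const_smul ε) (by norm_num)).trans ?_)
  rw [eLpNorm_const_smul, eLpNorm_const_smul, eLpNorm_norm, Real.enorm_of_nonneg hε,
    ENNReal.ofReal_mul hε, ENNReal.ofReal_add zero_le_one (by positivity), ENNReal.ofReal_one,
    mul_assoc, add_mul, one_mul, mul_add]
  gcongr

/-- A quasimode bounds the resolvent norm of every extension from below. -/
theorem le_resolventNorm_of_quasimode {V : ℝ → ℂ} (hV : Continuous V) {H : L2R →ₗ.[ℂ] L2R}
    (hH : IsClosedExtension V H) {f : ℝ → ℂ} (hf : ContDiff ℝ ∞ f) (hfc : HasCompactSupport f)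
    (hf0 : eLpNorm f 2 volume ≠ 0) {w : ℂ} {ε : ℝ} (hε : 0 < ε)
    (hq : eLpNorm (fun x => schrodingerExpr V f x - w * f x) 2 volume ≤
      ENNReal.ofReal ε * eLpNorm f 2 volume) :
    ENNReal.ofReal (1 / ε) ≤ resolventNorm H w := by
  have hfL : MemLp f 2 volume := hf.continuous.memLp_of_hasCompactSupport hfc
  have hd2 : HasCompactSupport (iteratedDeriv 2 f) := by
    rw [iteratedDeriv_succ, iteratedDeriv_one]; exact hfc.deriv.deriv
  have hgc : Continuous (schrodingerExpr V f) :=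
    ((contDiff_infty.1 hf 2).continuous_iteratedDeriv 2 le_rfl).neg.add (hV.mul hf.continuous)
  have hgs : HasCompactSupport (schrodingerExpr V f) := hd2.neg.add hfc.mul_left
  have hgL : MemLp (schrodingerExpr V f) 2 volume := hgc.memLp_of_hasCompactSupport hgs
  have hgraph : (hfL.toLp f, hgL.toLp _) ∈ H.graph :=
    hH.2 ⟨f, hf, hfc, hfL.coeFn_toLp, hgL.coeFn_toLp⟩
  obtain ⟨u, hu, hHu⟩ := (LinearPMap.mem_graph_iff _).1 hgraph
  have hu' : (u : L2R) = hfL.toLp f := hu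
  have hHu' : H u = hgL.toLp _ := hHu
  have hnu : ‖(u : L2R)‖ₑ = eLpNorm f 2 volume := by rw [hu', Lp.enorm_toLp]
  have hnv : ‖H u - w • (u : L2R)‖ₑ =
      eLpNorm (fun x => schrodingerExpr V f x - w * f x) 2 volume := by
    rw [hHu', hu', ← MemLp.toLp_const_smul, ← MemLp.toLp_sub, Lp.enorm_toLp]
    rfl
  -- Only u = R(H - w)u is needed. At a spectral point there is no R and the bound is vacuous.
  refine le_iInf₂ fun R hR => ?_
  have h1 : eLpNorm f 2 volume ≤ ‖R‖ₑ * ENNReal.ofReal ε * eLpNorm f 2 volume := by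
    calc eLpNorm f 2 volume = ‖R (H u - w • (u : L2R))‖ₑ := by rw [hR.2 u, hnu]
      _ ≤ ‖R‖ₑ * ‖H u - w • (u : L2R)‖ₑ := R.le_opENorm _
      _ ≤ ‖R‖ₑ * (ENNReal.ofReal ε * eLpNorm f 2 volume) := by rw [hnv]; gcongr
      _ = _ := (mul_assoc _ _ _).symm
  have h2 : 1 ≤ ‖R‖ₑ * ENNReal.ofReal ε := by
    by_contra! h3
    have := ENNReal.mul_lt_mul_left hf0 hfL.eLpNorm_ne_top h3
    rw [one_mul] at this
    exact absurd h1 (not_le.2 this)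
  rw [ENNReal.ofReal_div_of_pos hε, ENNReal.ofReal_one]
  exact ENNReal.div_le_of_le_mul h2

/-! ### Rescaling and the choice of the base point. -/

/-- The polynomial potential rescaled by `x = s y`, divided by `s ^ n` and shifted by `z`. -/
noncomputable def scaledPotential (n : ℕ) (c : ℕ → ℂ) (z : ℂ) (s : ℝ) (y : ℂ) : ℂ :=
  ∑ m ∈ Finset.Icc 1 n, c m * ((s : ℂ) ^ m / (s : ℂ) ^ n) * y ^ m - z

theorem differentiable_scaledPotential (n : ℕ) (c : ℕ → ℂ) (z : ℂ) (s : ℝ) :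
    Differentiable ℂ (scaledPotential n c z s) := by
  unfold scaledPotential
  fun_prop

/-- Each term with m < n carries s^(m-n) ≤ 1/s for s ≥ 1, so on a ball the difference from the limit
is at most B/s. -/
theorem tendstoUniformlyOn_scaledPotential {n : ℕ} (hn : 0 < n) (c : ℕ → ℂ) (z a : ℂ) (r : ℝ) :
    TendstoUniformlyOn (scaledPotential n c z) (fun y => c n * y ^ n - z) atTop
      (Metric.ball a r) := by
  set R : ℝ := ‖a‖ + |r| with hR
  set B : ℝ := ∑ m ∈ Finset.Ico 1 n, ‖c m‖ * R ^ m with hB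
  have hB0 : 0 ≤ B := Finset.sum_nonneg fun m _ => by positivity
  rw [Metric.tendstoUniformlyOn_iff]
  intro ε hε
  have ht : Tendsto (fun s : ℝ => B * s⁻¹) atTop (𝓝 0) := by
    simpa using tendsto_inv_atTop_zero.const_mul B
  filter_upwards [ht.eventually_lt_const hε, eventually_ge_atTop 1] with s hs hs1 y hy
  have hs0 : (s : ℂ) ≠ 0 := by
    have : s ≠ 0 := by positivity
    exact_mod_cast this
  have hy' : ‖y‖ ≤ R := by
    rw [Metric.mem_ball, dist_eq_norm] at hy
    linarith [norm_le_norm_add_norm_sub' y a, le_abs_self r]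
  refine lt_of_le_of_lt ?_ hs
  rw [dist_comm, dist_eq_norm, scaledPotential, ← Finset.Ico_insert_right hn,
    Finset.sum_insert Finset.right_notMem_Ico, div_self (pow_ne_zero n hs0)]
  rw [show ∀ p q t : ℂ, p * 1 * q + t - z - (p * q - z) = t by intros; ring, hB, Finset.sum_mul]
  refine norm_sum_le_of_le _ fun m hm => ?_
  rw [Finset.mem_Ico] at hm
  rw [norm_mul, norm_mul, norm_pow, norm_div, norm_pow, norm_pow, Complex.norm_real,
    Real.norm_of_nonneg (by positivity), mul_right_comm]
  gcongr
  rw [div_le_iff₀ (by positivity), ← div_eq_inv_mul, le_div_iff₀ (by positivity), ← pow_succ]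
  exact pow_le_pow_right₀ hs1 (by omega)

/-- Rescaling of the Schrödinger operator. -/
theorem schrodingerExpr_comp_inv_mul {n k : ℕ} (hk : n = 2 * k) (c : ℕ → ℂ) (z : ℂ) {s : ℝ}
    (hs : 0 < s) {φ : ℝ → ℂ} (hφ : ContDiff ℝ ∞ φ) (x : ℝ) :
    schrodingerExpr (polyPotential n c) (fun x => φ (s⁻¹ * x)) x -
        ((s ^ n : ℝ) : ℂ) * z * φ (s⁻¹ * x) =
      (s : ℂ) ^ n * (-((s⁻¹ ^ (k + 1) : ℝ) : ℂ) ^ 2 * iteratedDeriv 2 φ (s⁻¹ * x) +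
        scaledPotential n c z s ((s⁻¹ * x : ℝ) : ℂ) * φ (s⁻¹ * x)) := by
  have hs0 : (s : ℂ) ≠ 0 := by exact_mod_cast hs.ne'
  have hV : polyPotential n c x =
      (s : ℂ) ^ n * (scaledPotential n c z s ((s⁻¹ * x : ℝ) : ℂ) + z) := by
    rw [polyPotential, scaledPotential, sub_add_cancel, Finset.mul_sum]
    refine Finset.sum_congr rfl fun m _ => ?_
    push_cast
    rw [mul_pow, inv_pow]
    field_simp
  -- With n = 2k, h = s^{-(k+1)} satisfies sⁿh² = s⁻², the factor produced by two derivatives in x.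
  have h2 : (s : ℂ) ^ n * ((s⁻¹ ^ (k + 1) : ℝ) : ℂ) ^ 2 = (s : ℂ)⁻¹ ^ 2 := by
    push_cast
    rw [hk, inv_pow, inv_pow, inv_pow, ← pow_mul,
      show (s : ℂ) ^ ((k + 1) * 2) = s ^ (2 * k) * s ^ 2 by ring]
    field_simp
  rw [schrodingerExpr, hV, iteratedDeriv_comp_const_smul (contDiff_infty.1 hφ 2)]
  simp only [Complex.real_smul, Complex.ofReal_pow, Complex.ofReal_inv]
  simp only [Complex.ofReal_pow, Complex.ofReal_inv] at h2
  linear_combination (-iteratedDeriv 2 φ (s⁻¹ * x)) * (-h2)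

/-- A point where the classical symbol `ξ² + c xⁿ` takes the value `z`. -/
theorem exists_symbol_eq {n : ℕ} (hn : n ≠ 0) {c z : ℂ} (hre : 0 < c.re) (him : 0 < c.im)
    (hz0 : 0 < z.arg) (hz1 : z.arg < c.arg) :
    ∃ a η : ℝ, 0 < a ∧ 0 < η ∧ c * (a : ℂ) ^ n - z = -(η : ℂ) ^ 2 := by
  have hcarg : c.arg < Real.pi / 2 :=
    (abs_lt.1 (Complex.abs_arg_lt_pi_div_two_iff.2 (Or.inl hre))).2
  have hz : z ≠ 0 := by rintro rfl; simp at hz0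
  have hc : c ≠ 0 := by rintro rfl; simp at hre
  have hzim : 0 < z.im := by
    rw [← Complex.norm_mul_sin_arg]
    exact mul_pos (norm_pos_iff.2 hz) (Real.sin_pos_of_pos_of_lt_pi hz0 (by linarith [Real.pi_pos]))
  -- The determinant is |z||c| sin(arg c - arg z).
  have hdet : 0 < z.re * c.im - c.re * z.im := by
    rw [← Complex.norm_mul_sin_arg z, ← Complex.norm_mul_sin_arg c, ← Complex.norm_mul_cos_arg z,
      ← Complex.norm_mul_cos_arg c]
    have h1 : 0 < Real.sin (c.arg - z.arg) :=
      Real.sin_pos_of_pos_of_lt_pi (by linarith) (by linarith [Real.pi_pos])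
    rw [Real.sin_sub] at h1
    have := mul_pos (mul_pos (norm_pos_iff.2 hz) (norm_pos_iff.2 hc)) h1
    linarith
  -- The value t = aⁿ makes ct - z real; it then equals minus the determinant over Im c, hence is
  -- negative.
  set t : ℝ := z.im / c.im with ht
  have ht0 : 0 < t := by positivity
  have hE : 0 < z.re - c.re * t := by
    have : z.re - c.re * t = (z.re * c.im - c.re * z.im) / c.im := by rw [ht]; field_simp
    rw [this]; positivity
  refine ⟨t ^ (n : ℝ)⁻¹, Real.sqrt (z.re - c.re * t), by positivity, Real.sqrt_pos.2 hE, ?_⟩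
  rw [← Complex.ofReal_pow, Real.rpow_inv_natCast_pow ht0.le hn, ← Complex.ofReal_pow,
    Real.sq_sqrt hE.le]
  apply Complex.ext
  · simp
  · simp [ht, mul_div_cancel₀ _ him.ne']

/-! ### Assembly. -/

/-- Polynomial lower bounds of every order for the resolvent norm. -/
theorem exists_le_resolventNorm {n : ℕ} (hn : Even n) (hn0 : 0 < n) {c : ℕ → ℂ}
    (hre : 0 < (c n).re) (him : 0 < (c n).im)
    {H : L2R →ₗ.[ℂ] L2R} (hH : IsClosedExtension (polyPotential n c) H)
    {z : ℂ} (hz0 : 0 < z.arg) (hz1 : z.arg < (c n).arg) (p : ℕ) :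
    ∃ C > 0, ∀ᶠ s : ℝ in atTop,
      ENNReal.ofReal (s ^ p / C) ≤ resolventNorm H (((s ^ n : ℝ) : ℂ) * z) := by
  obtain ⟨k, hk⟩ := hn.two_dvd
  obtain ⟨a, η, ha, hη, hsym⟩ := exists_symbol_eq hn0.ne' hre him hz0 hz1
  have hh : Tendsto (fun s : ℝ => s⁻¹ ^ (k + 1)) atTop (𝓝[>] 0) := by
    refine tendsto_nhdsWithin_iff.2 ⟨?_, ?_⟩
    · simpa using (tendsto_inv_atTop_zero (𝕜 := ℝ)).pow (k + 1)
    · filter_upwards [eventually_gt_atTop 0] with s hs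
      exact pow_pos (inv_pos.2 hs) _
  have hW₀ : Differentiable ℂ fun y : ℂ => c n * y ^ n - z := by fun_prop
  have hderiv : 0 < (deriv (fun y : ℂ => c n * y ^ n - z) a).im := by
    have h1 : HasDerivAt (fun y : ℂ => c n * y ^ n - z) (c n * (n * (a : ℂ) ^ (n - 1))) a :=
      ((hasDerivAt_pow n (a : ℂ)).const_mul (c n)).sub_const z
    have h2 : c n * (n * (a : ℂ) ^ (n - 1)) = ((n * a ^ (n - 1) : ℝ) : ℂ) * c n := by
      push_cast; ring
    rw [h1.deriv, h2, Complex.im_ofReal_mul]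
    positivity
  -- Since h ≤ 1/s, of the n + p + 1 powers of h, n cancel the factor sⁿ, p give the rate s^(-p),
  -- and one pays for A = h⁻¹ in the norm comparison.
  obtain ⟨b, hb, hq⟩ := exists_quasimode_of_tendstoUniformlyOn one_pos hη hh
    (Eventually.of_forall fun s => (differentiable_scaledPotential n c z s).differentiableOn)
    hW₀.differentiableOn (tendstoUniformlyOn_scaledPotential hn0 c z a 1) hsym hderiv (n + p + 1)
  refine ⟨1 + 1 / b, by positivity, ?_⟩
  filter_upwards [hq, eventually_ge_atTop 1] with s ⟨φ, hφ, hφc, hlow, hin, hout⟩ hs1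
  have hs : 0 < s := by linarith
  set h : ℝ := s⁻¹ ^ (k + 1) with hdef
  have hpos : 0 < h := by positivity
  have hinv1 : s⁻¹ ≤ 1 := inv_le_one_of_one_le₀ hs1
  have hh1 : h ≤ 1 := pow_le_one₀ (by positivity) hinv1
  have hhs : h ≤ s⁻¹ :=
    (pow_le_pow_of_le_one (by positivity) hinv1 (Nat.le_add_left 1 k)).trans_eq (pow_one _)
  set f : ℝ → ℂ := fun x => φ (s⁻¹ * x) with hfdef
  have hf : ContDiff ℝ ∞ f := hφ.comp (contDiff_const.mul contDiff_id)
  have hfc : HasCompactSupport f :=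
    hφc.comp_homeomorph (Homeomorph.mulLeft₀ s⁻¹ (by positivity))
  have hball : ∀ (ρ x : ℝ), x ∈ Metric.closedBall (s * a) (s * ρ) ↔
      s⁻¹ * x ∈ Metric.closedBall a ρ := by
    intro ρ x
    rw [Metric.mem_closedBall, Metric.mem_closedBall, Real.dist_eq, Real.dist_eq,
      show x - s * a = s * (s⁻¹ * x - a) by field_simp, abs_mul, abs_of_pos hs,
      mul_le_mul_iff_right₀ hs]
  have hVc : Continuous (polyPotential n c) := by
    unfold polyPotential; fun_prop
  set ε : ℝ := s ^ n * h ^ (n + p + 1) with hεdef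
  have hε : 0 < ε := by positivity
  have hnorm : ∀ x, ‖schrodingerExpr (polyPotential n c) f x - ((s ^ n : ℝ) : ℂ) * z * f x‖ =
      s ^ n * ‖-(h : ℂ) ^ 2 * iteratedDeriv 2 φ (s⁻¹ * x) +
        scaledPotential n c z s ((s⁻¹ * x : ℝ) : ℂ) * φ (s⁻¹ * x)‖ := by
    intro x
    rw [hfdef, schrodingerExpr_comp_inv_mul hk c z hs hφ, norm_mul, norm_pow, Complex.norm_real,
      Real.norm_of_nonneg hs.le]
  -- The intervals have length ratio 1/h ≤ h⁻², so the choice A = h⁻¹ suffices and avoids a square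
  -- root.
  have hL2 := eLpNorm_two_le_of_pointwise (f := f)
    (v := fun x => schrodingerExpr (polyPotential n c) f x - ((s ^ n : ℝ) : ℂ) * z * f x)
    (I := Metric.closedBall (s * a) (s * h)) (J := Metric.closedBall (s * a) (s * 1))
    hf.continuous.aestronglyMeasurable Metric.isClosed_closedBall.measurableSet
    Metric.isClosed_closedBall.measurableSet hε.le hb (A := h⁻¹) (by positivity) ?_ ?_ ?_ ?_
  · have hf0 : eLpNorm f 2 volume ≠ 0 := by
      intro h0
      rw [eLpNorm_eq_zero_iff hf.continuous.aestronglyMeasurable two_ne_zero,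
        Continuous.ae_eq_iff_eq volume hf.continuous continuous_zero] at h0
      have h1 := hlow (s⁻¹ * (s * a)) ((hball h _).1 (Metric.mem_closedBall_self (by positivity)))
      have h2 : φ (s⁻¹ * (s * a)) = 0 := congrFun h0 (s * a)
      rw [h2, norm_zero] at h1
      linarith
    have hC : 0 < (1 + 1 / b) / s ^ p := by positivity
    have hle : ε * (1 + h⁻¹ / b) ≤ (1 + 1 / b) / s ^ p := by
      calc ε * (1 + h⁻¹ / b) = s ^ n * h ^ (n + p) * (h + 1 / b) := by
            rw [hεdef, pow_succ]; field_simp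
        _ ≤ s ^ n * s⁻¹ ^ (n + p) * (1 + 1 / b) := by gcongr
        _ = (1 + 1 / b) / s ^ p := by rw [inv_pow, pow_add]; field_simp
    have := le_resolventNorm_of_quasimode hVc hH hf hfc hf0 hC
      (hL2.trans (by gcongr))
    rwa [one_div_div] at this
  · rw [Real.volume_closedBall, Real.volume_closedBall, ← ENNReal.ofReal_mul (by positivity)]
    apply ENNReal.ofReal_le_ofReal
    have : h⁻¹ ^ 2 * (2 * (s * h)) = 2 * s * h⁻¹ := by field_simp
    rw [this, mul_one]
    exact le_mul_of_one_le_right (by positivity) (one_le_inv₀ hpos |>.2 hh1)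
  · exact fun x hx => hlow _ ((hball h x).1 hx)
  · intro x hx
    rw [hnorm, hεdef, mul_assoc]
    gcongr
    exact hin _ ((hball 1 x).1 hx)
  · intro x hx
    rw [hnorm, hεdef, mul_assoc]
    gcongr
    exact hout _ (fun hx' => hx ((hball 1 x).2 hx'))

theorem theorem2 (n : ℕ) (hn : Even n) (hn0 : 0 < n) (c : ℕ → ℂ)
    (hre : 0 < (c n).re) (him : 0 < (c n).im)
    (H : L2R →ₗ.[ℂ] L2R) (hH : IsClosedExtension (polyPotential n c) H)
    (z : ℂ) (hz0 : 0 < z.arg) (hz1 : z.arg < (c n).arg) (N : ℝ) :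
    Tendsto (fun σ : ℝ => resolventNorm H ((σ : ℂ) * z) / ENNReal.ofReal (σ ^ N))
      atTop (𝓝 ∞) := by
  -- With s = σ^(1/n), order n * p gives σ^p / C; since p ≥ N + 1, the quotient by σ^N is at least σ
  -- / C.
  obtain ⟨p, hp⟩ := exists_nat_ge (N + 1)
  obtain ⟨C, hC, hlow⟩ := exists_le_resolventNorm hn hn0 hre him hH hz0 hz1 (n * p)
  have hn' : (0 : ℝ) < (n : ℝ)⁻¹ := by positivity
  refine tendsto_nhds_top_mono
    (ENNReal.tendsto_ofReal_atTop.comp (tendsto_id.atTop_div_const hC)) ?_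
  filter_upwards [(tendsto_rpow_atTop hn').eventually hlow, eventually_ge_atTop 1] with σ hσ hσ1
  have hσ0 : 0 < σ := by linarith
  have hpow : 0 < σ ^ N := by positivity
  rw [pow_mul, Real.rpow_inv_natCast_pow hσ0.le hn0.ne'] at hσ
  simp only [Function.comp_apply, id]
  rw [ENNReal.le_div_iff_mul_le (Or.inl (by simpa using hpow)) (Or.inl ENNReal.ofReal_ne_top),
    ← ENNReal.ofReal_mul (by positivity)]
  refine le_trans (ENNReal.ofReal_le_ofReal ?_) hσ
  rw [div_mul_eq_mul_div]
  gcongr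
  calc σ * σ ^ N = σ ^ (N + 1) := by rw [Real.rpow_add_one hσ0.ne', mul_comm]
    _ ≤ σ ^ (p : ℝ) := Real.rpow_le_rpow_of_exponent_le hσ1 hp
    _ = σ ^ p := Real.rpow_natCast _ _
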